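/- Let $l\ge 2$ and let $\Phi=\{\phi_i\}_{i=1}^l$ be an iterated function system of contracting similarities of the Euclidean plane, $\phi_i(z)=\alpha_iO_iz+t_i$ with $0<|\alpha_i|<1$, $O_i\in O(\mathbb R^2)$ (the orthogonal part of $\phi_i$) and $t_i\in\mathbb R^2$. Let $F$ be its attractor, i.e. the unique nonempty compact set with $F=\bigcup_i\phi_i(F)$, and let $G_\Phi\le O(\mathbb R^2)$ be the group generated by $O_1,\dots,O_l$. $\Phi$ satisfies the strong separation condition (SSC) if $\phi_i(F)\cap\phi_j(F)=\emptyset$ for all $i\ne j$. Let $\mu$ be a self-similar measure with respect to $\Phi$, i.e. a Borel probability measure on $\mathbb R^2$ with $\mu=\sum_{i=1}^l p_i\,\mu\circ\phi_i^{-1}$ for some $p_1,\dots,p_l>0$ with $\sum_i p_i=1$. A Borel probability measure $\nu$ on $\mathbb R^2$ is exact dimensional of dimension $s$ if $\lim_{r\to0^+}\log\nu(B(x,r))/\log r=s$ for $\nu$-a.e. $x$. We say that $\mu$ admits a $1$-slicing if there is a one-dimensional linear subspace $V\subset\mathbb R^2$ such that (i) $O_i(V)=V$ for every $i$, and (ii)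 for $P_{V^\perp}\mu$-a.e. $y\in V^\perp$, the conditional measure of $\mu$ on the translate $V+y$, obtained by disintegrating $\mu$ along the orthogonal projection $P_{V^\perp}:\mathbb R^2\to V^\perp$, is exact dimensional of dimension $1$. Then: 1. If $|G_\Phi|\ge 5$ or $|G_\Phi\cap SO(\mathbb R^2)|>2$ (infinite cardinalities allowed), then $\mu$ does not admit a $1$-slicing. 2. If $\Phi$ satisfies the SSC, then $\mu$ does not admit a $1$-slicing. -/

import Mathlib

open MeasureTheory ProbabilityTheory Filter Topology
open scoped NNReal

/-- The Euclidean plane. -/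
abbrev Plane : Type := EuclideanSpace ℝ (Fin 2)

/-- The orthogonal group of the plane, under composition. -/
abbrev PlaneOrthogonal : Type := Plane ≃ₗᵢ[ℝ] Plane

/-- The group of rotations, i.e. orthogonal maps of determinant one. -/
noncomputable def planeRotations : Subgroup PlaneOrthogonal where
  carrier := {O | LinearMap.det (O.toLinearEquiv : Plane →ₗ[ℝ] Plane) = 1}
  mul_mem' := by
    intro a b ha hb
    simp only [Set.mem_ofPred_eq] at ha hb ⊢
    have h : ((a * b).toLinearEquiv : Plane →ₗ[ℝ] Plane)
        = (a.toLinearEquiv : Plane →ₗ[ℝ] Plane) * (b.toLinearEquiv : Plane →ₗ[ℝ] Plane) := rfl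
    rw [h, map_mul, ha, hb, one_mul]
  one_mem' := by
    simp only [Set.mem_ofPred_eq]
    have h : ((1 : PlaneOrthogonal).toLinearEquiv : Plane →ₗ[ℝ] Plane) = 1 := rfl
    rw [h, map_one]
  inv_mem' := by
    intro a ha
    simp only [Set.mem_ofPred_eq] at ha ⊢
    have h : (a⁻¹.toLinearEquiv : Plane →ₗ[ℝ] Plane) * (a.toLinearEquiv : Plane →ₗ[ℝ] Plane)
        = 1 := by
      ext1 x
      exact a.symm_apply_apply x
    have h2 := congrArg LinearMap.det h
    rw [map_mul, ha, mul_one, map_one] at h2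
    exact h2

/-- An iterated function system of `l ≥ 2` contracting similarities
`z ↦ α i • O i z + t i` of the plane, with `α i ≠ 0`, `|α i| < 1` and `O i` orthogonal. -/
structure SimilarityIFS (l : ℕ) where
  two_le : 2 ≤ l
  ratio : Fin l → ℝ
  orth : Fin l → PlaneOrthogonal
  trans : Fin l → Plane
  ratio_ne_zero : ∀ i, ratio i ≠ 0
  abs_ratio_lt_one : ∀ i, |ratio i| < 1

namespace SimilarityIFS

variable {l : ℕ}

/-- The `i`-th similarity of the system. -/
noncomputable def toMap (Φ : SimilarityIFS l) (i : Fin l) (z : Plane) : Plane :=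
  Φ.ratio i • Φ.orth i z + Φ.trans i

/-- `F` is the attractor of `Φ` (the unique nonempty compact set with `F = ⋃ φ_i(F)`). -/
def IsAttractor (Φ : SimilarityIFS l) (F : Set Plane) : Prop :=
  F.Nonempty ∧ IsCompact F ∧ F = ⋃ i, Φ.toMap i '' F

/-- Strong separation condition: the sets `φ_i(F)`, with `F` the attractor, are pairwise
disjoint. -/
def SSC (Φ : SimilarityIFS l) : Prop :=
  ∃ F : Set Plane, Φ.IsAttractor F ∧
    ∀ i j, i ≠ j → Disjoint (Φ.toMap i '' F) (Φ.toMap j '' F)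

/-- The group generated by the orthogonal parts of the maps of `Φ`. -/
noncomputable def orthGroup (Φ : SimilarityIFS l) : Subgroup PlaneOrthogonal :=
  Subgroup.closure (Set.range Φ.orth)

/-- `μ` is a self similar measure with respect to `Φ`: a Borel probability measure with
`μ = ∑ p i • (φ_i)_* μ` for some probability vector `p` with positive entries. -/
def IsSelfSimilarMeasure (Φ : SimilarityIFS l) (μ : Measure Plane) : Prop :=
  IsProbabilityMeasure μ ∧
    ∃ p : Fin l → ℝ≥0, (∀ i, 0 < p i) ∧ ∑ i, p i = 1 ∧
      μ = ∑ i, p i • μ.map (Φ.toMap i)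

end SimilarityIFS

/-- `ν` is exact dimensional, of dimension `s`: its local dimension exists and equals `s` at
`ν`-almost every point. -/
def IsExactDimensional (ν : Measure Plane) (s : ℝ) : Prop :=
  ∀ᵐ x ∂ν, Tendsto (fun r : ℝ => Real.log (ν.real (Metric.closedBall x r)) / Real.log r)
    (𝓝[>] 0) (𝓝 s)

/-- The conditional measures of `μ` on the translates of `V`: the disintegration of `μ` along
the orthogonal projection onto `Vᗮ`, as a Markov kernel from `Vᗮ` to the plane. -/
noncomputable def sliceMeasure (μ : Measure Plane) [IsFiniteMeasure μ]
    (V : Submodule ℝ Plane) : Kernel Vᗮ Plane :=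
  condDistrib id (Vᗮ.orthogonalProjectionOnto) μ

/-- `μ` admits a 1-slicing (as a measure associated with `Φ`): there is a line `V` through the
origin, invariant under all orthogonal parts of maps of `Φ`, such that almost all conditional
measures of `μ` on translates of `V` are exact dimensional of dimension one. -/
def AdmitsOneSlicing {l : ℕ} (Φ : SimilarityIFS l) (μ : Measure Plane) [IsFiniteMeasure μ] :
    Prop :=
  ∃ V : Submodule ℝ Plane, Module.finrank ℝ V = 1 ∧
    (∀ i, V.map ((Φ.orth i).toLinearEquiv : Plane →ₗ[ℝ] Plane) = V) ∧
    ∀ᵐ y ∂(μ.map (Vᗮ.orthogonalProjectionOnto)), IsExactDimensional (sliceMeasure μ V y) 1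

/-! ### Isometries of the plane preserving a line -/

/-! The first claim is linear algebra. An orthogonal map preserving a line sends a unit vector of
the line to plus or minus itself, hence does the same to a unit normal. So `orthGroup` embeds into
pairs of signs, and determinant one forces the two signs to agree.

For the second, the attractor `F` contains no segment parallel to `V`: by connectedness such a
segment lies in a single piece, and pulling it back repeatedly makes it longer than the diameter of
`F` (`exists_add_notMem`). Compactness and self-similarity turn this into porosity along `V` that is
uniform in point and scale (`exists_porous`). Since `μ` lives on `F`, almost every slice measure is
carried by a slice of `F` (`ae_sliceMeasure`), which is a bounded porous subset of a line. Such a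
set meets at most `C * (N - 1) ^ n` of the `N`-adic intervals of level `n`, too few to carry a
measure of local dimension one. -/

lemma exists_orthonormalBasis_span_singleton_eq {V : Submodule ℝ Plane}
    (hV : Module.finrank ℝ V = 1) :
    ∃ b : OrthonormalBasis (Fin 2) ℝ Plane, V = Submodule.span ℝ {b 0} := by
  obtain ⟨v, hv0, hv⟩ := finrank_eq_one_iff'.1 hV
  have hn : ‖(v : Plane)‖ ≠ 0 := by simpa using hv0
  set e : Plane := ‖(v : Plane)‖⁻¹ • (v : Plane) with he
  have hen : ‖e‖ = 1 := by
    rw [he, norm_smul, norm_inv, norm_norm, inv_mul_cancel₀ hn]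
  have hor : Orthonormal ℝ (({0} : Set (Fin 2)).domRestrict fun _ => e) := by
    constructor
    · intro i
      simpa using hen
    · intro i j hij
      exact absurd (Subsingleton.elim i j) hij
  obtain ⟨b, hb⟩ := hor.exists_orthonormalBasis_extension_of_card_eq (by simp)
  refine ⟨b, ?_⟩
  rw [hb 0 rfl]
  apply le_antisymm
  · intro w hw
    obtain ⟨c, hc⟩ := hv ⟨w, hw⟩
    have hc' : c • (v : Plane) = w := congrArg Subtype.val hc
    rw [Submodule.mem_span_singleton]
    refine ⟨c * ‖(v : Plane)‖, ?_⟩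
    rw [he, smul_smul, mul_assoc, mul_inv_cancel₀ hn, mul_one, hc']
  · rw [Submodule.span_singleton_le_iff_mem]
    exact V.smul_mem _ v.2

lemma eq_or_eq_neg_of_mem_span_singleton {E : Type*} [NormedAddCommGroup E] [NormedSpace ℝ E]
    {u w : E} (hu : ‖u‖ = 1) (hw : ‖w‖ = 1) (h : w ∈ Submodule.span ℝ {u}) : w = u ∨ w = -u := by
  obtain ⟨c, rfl⟩ := Submodule.mem_span_singleton.1 h
  rw [norm_smul, hu, mul_one, Real.norm_eq_abs] at hw
  rcases eq_or_eq_neg_of_abs_eq hw with rfl | rfl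
  · left; simp
  · right; simp

lemma orthGroup_apply_eq_or_eq_neg {l : ℕ} {Φ : SimilarityIFS l} {u : Plane} (hu : ‖u‖ = 1)
    (hV : ∀ i, (Submodule.span ℝ {u}).map ((Φ.orth i).toLinearEquiv : Plane →ₗ[ℝ] Plane)
      = Submodule.span ℝ {u}) {g : PlaneOrthogonal} (hg : g ∈ Φ.orthGroup) :
    g u = u ∨ g u = -u := by
  induction hg using Subgroup.closure_induction with
  | mem g hg =>
    obtain ⟨i, rfl⟩ := hg
    refine eq_or_eq_neg_of_mem_span_singleton hu (by simpa using hu) ?_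
    rw [← hV i]
    exact Submodule.mem_map_of_mem (Submodule.mem_span_singleton_self u)
  | one => left; rfl
  | mul a b _ _ ha hb =>
    change a (b u) = u ∨ a (b u) = -u
    rcases ha with ha | ha <;> rcases hb with hb | hb <;> simp [ha, hb]
  | inv a _ ha =>
    rcases ha with ha | ha
    · left
      exact (LinearIsometryEquiv.symm_apply_eq a).2 ha.symm
    · right
      refine (LinearIsometryEquiv.symm_apply_eq a).2 ?_
      rw [map_neg, ha, neg_neg]

/-- Preserving inner products, `g` keeps `b 1` orthogonal to the line of `b 0`. -/
lemma apply_one_eq_or_eq_neg (b : OrthonormalBasis (Fin 2) ℝ Plane) {g : PlaneOrthogonal}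
    (hg : g (b 0) = b 0 ∨ g (b 0) = -b 0) : g (b 1) = b 1 ∨ g (b 1) = -b 1 := by
  have h01 : inner ℝ (b 0) (b 1) = 0 := b.orthonormal.2 (by decide)
  have h0 : inner ℝ (b 0) (g (b 1)) = 0 := by
    have := g.inner_map_map (b 0) (b 1)
    rcases hg with hg | hg <;> rw [hg] at this <;> simpa [h01] using this
  refine eq_or_eq_neg_of_mem_span_singleton (b.orthonormal.1 1)
    (by simp) ?_
  rw [Submodule.mem_span_singleton]
  refine ⟨inner ℝ (b 1) (g (b 1)), ?_⟩
  have := b.sum_repr' (g (b 1))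
  rw [Fin.sum_univ_two, h0, zero_smul, zero_add] at this
  exact this

lemma det_eq_mul_of_apply_eq_smul (b : OrthonormalBasis (Fin 2) ℝ Plane)
    {f : Plane →ₗ[ℝ] Plane} {s t : ℝ} (h0 : f (b 0) = s • b 0) (h1 : f (b 1) = t • b 1) :
    LinearMap.det f = s * t := by
  rw [← LinearMap.det_toMatrix b.toBasis, Matrix.det_fin_two]
  simp only [LinearMap.toMatrix_apply, OrthonormalBasis.coe_toBasis, h0, h1, map_smul]
  simp

lemma ext_orthonormalBasis (b : OrthonormalBasis (Fin 2) ℝ Plane) {g h : PlaneOrthogonal}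
    (h0 : g (b 0) = h (b 0)) (h1 : g (b 1) = h (b 1)) : g = h := by
  have : g.toLinearEquiv.toLinearMap = h.toLinearEquiv.toLinearMap := by
    refine b.toBasis.ext fun i => ?_
    fin_cases i
    · simpa using h0
    · simpa using h1
  ext1 x
  exact LinearMap.congr_fun this x

lemma eq_of_iff_of_eq_or_eq_neg {E : Type*} [AddGroup E] {u v w : E} (hv : v = u ∨ v = -u)
    (hw : w = u ∨ w = -u) (h : v = u ↔ w = u) : v = w := by
  rcases hv with rfl | hv
  · exact (h.1 rfl).symm
  · rcases hw with rfl | hw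
    · exact h.2 rfl
    · rw [hv, hw]

open Classical in
lemma card_orthGroup_le_four {l : ℕ} {Φ : SimilarityIFS l} (b : OrthonormalBasis (Fin 2) ℝ Plane)
    (hV : ∀ i, (Submodule.span ℝ {b 0}).map ((Φ.orth i).toLinearEquiv : Plane →ₗ[ℝ] Plane)
      = Submodule.span ℝ {b 0}) :
    ENat.card Φ.orthGroup ≤ 4 := by
  have hinj : Function.Injective fun g : Φ.orthGroup =>
      (decide (g.1 (b 0) = b 0), decide (g.1 (b 1) = b 1)) := by
    intro g h hgh
    simp only [Prod.mk.injEq, decide_eq_decide] at hgh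
    have hg := orthGroup_apply_eq_or_eq_neg (b.orthonormal.1 0) hV g.2
    have hh := orthGroup_apply_eq_or_eq_neg (b.orthonormal.1 0) hV h.2
    exact Subtype.ext (ext_orthonormalBasis b (eq_of_iff_of_eq_or_eq_neg hg hh hgh.1)
      (eq_of_iff_of_eq_or_eq_neg (apply_one_eq_or_eq_neg b hg) (apply_one_eq_or_eq_neg b hh) hgh.2))
  simpa using ENat.card_le_card_of_injective hinj

-- The determinant is the product of the two signs, so a rotation here is plus or minus the identity
-- and its sign on `b 0` determines it.
open Classical in
lemma card_orthGroup_inf_planeRotations_le_two {l : ℕ} {Φ : SimilarityIFS l}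
    (b : OrthonormalBasis (Fin 2) ℝ Plane)
    (hV : ∀ i, (Submodule.span ℝ {b 0}).map ((Φ.orth i).toLinearEquiv : Plane →ₗ[ℝ] Plane)
      = Submodule.span ℝ {b 0}) :
    ENat.card (Φ.orthGroup ⊓ planeRotations : Subgroup PlaneOrthogonal) ≤ 2 := by
  have key : ∀ g : (Φ.orthGroup ⊓ planeRotations : Subgroup PlaneOrthogonal),
      (g.1 (b 0) = b 0 ∧ g.1 (b 1) = b 1) ∨ (g.1 (b 0) = -b 0 ∧ g.1 (b 1) = -b 1) := by
    rintro ⟨g, hg, hdet⟩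
    have hdet : LinearMap.det (g.toLinearEquiv : Plane →ₗ[ℝ] Plane) = 1 := hdet
    have h0 := orthGroup_apply_eq_or_eq_neg (b.orthonormal.1 0) hV hg
    have h1 := apply_one_eq_or_eq_neg b h0
    rcases h0 with h0 | h0 <;> rcases h1 with h1 | h1
    · exact Or.inl ⟨h0, h1⟩
    · rw [det_eq_mul_of_apply_eq_smul b (s := 1) (t := -1) (by simpa using h0)
        (by simpa using h1)] at hdet
      norm_num at hdet
    · rw [det_eq_mul_of_apply_eq_smul b (s := -1) (t := 1) (by simpa using h0)
        (by simpa using h1)] at hdet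
      norm_num at hdet
    · exact Or.inr ⟨h0, h1⟩
  have hne : -b 0 ≠ b 0 := by
    intro h
    have h2 : (2 : ℝ) • b 0 = 0 := by
      rw [two_smul]
      nth_rewrite 1 [← h]
      exact neg_add_cancel _
    exact b.orthonormal.ne_zero 0 ((smul_eq_zero.1 h2).resolve_left two_ne_zero)
  have hinj : Function.Injective
      fun g : (Φ.orthGroup ⊓ planeRotations : Subgroup PlaneOrthogonal) =>
        decide (g.1 (b 0) = b 0) := by
    intro g h hgh
    simp only [decide_eq_decide] at hgh
    refine Subtype.ext (ext_orthonormalBasis b ?_ ?_) <;>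
    rcases key g with ⟨g0, g1⟩ | ⟨g0, g1⟩ <;> rcases key h with ⟨h0, h1⟩ | ⟨h0, h1⟩ <;>
    simp_all
  simpa using ENat.card_le_card_of_injective hinj

/-! ### Porous subsets of the line and exact dimensional measures -/

/-- The interval with index `k` has `N` children `k * N + j`, one of which misses `E`; so each level
multiplies the count by at most `N - 1`. The constant `C` counts the unit intervals meeting `E`. -/
lemma exists_finset_floor_mem_of_gap {E : Set ℝ} {N : ℕ} (hN : 2 ≤ N)
    (hfin : ((fun x : ℝ => ⌊x⌋) '' E).Finite)
    (hgap : ∀ n : ℕ, ∀ k : ℤ, ∃ j ∈ Finset.range N,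
      ∀ x ∈ E, ⌊x * (N : ℝ) ^ (n + 1)⌋ ≠ k * N + j) :
    ∃ C : ℕ, ∀ n : ℕ, ∃ S : Finset ℤ, S.card ≤ C * (N - 1) ^ n ∧
      ∀ x ∈ E, ⌊x * (N : ℝ) ^ n⌋ ∈ S := by
  refine ⟨hfin.toFinset.card, fun n => ?_⟩
  induction n with
  | zero =>
    refine ⟨hfin.toFinset, by simp, fun x hx => ?_⟩
    simpa using ⟨x, hx, rfl⟩
  | succ n ih =>
    obtain ⟨S, hS, hmem⟩ := ih
    choose j hj hjE using hgap n
    refine ⟨S.biUnion fun k => ((Finset.range N).erase (j k)).image fun i : ℕ => k * N + i,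
      ?_, fun x hx => ?_⟩
    · calc _ ≤ S.card * (N - 1) := by
            refine Finset.card_biUnion_le_card_mul _ _ _ fun k _ => ?_
            refine Finset.card_image_le.trans ?_
            rw [Finset.card_erase_of_mem (hj k), Finset.card_range]
        _ ≤ hfin.toFinset.card * (N - 1) ^ n * (N - 1) := Nat.mul_le_mul_right _ hS
        _ = _ := by rw [pow_succ, mul_assoc]
    · have hN0 : (0 : ℤ) < N := by omega
      have hN0' : (0 : ℝ) < N := by exact_mod_cast hN0
      set m : ℤ := ⌊x * (N : ℝ) ^ (n + 1)⌋ with hm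
      have hdiv : m / N = ⌊x * (N : ℝ) ^ n⌋ := by
        rw [hm, ← Int.floor_div_natCast]
        congr 1
        rw [pow_succ, ← mul_assoc, mul_div_cancel_right₀ _ hN0'.ne']
      have hmod := Int.emod_nonneg m hN0.ne'
      have hmod' := Int.emod_lt_of_pos m hN0
      have hcast : ((m % N).toNat : ℤ) = m % N := Int.toNat_of_nonneg hmod
      have hsum : m / N * N + m % N = m := by
        rw [mul_comm]; exact Int.mul_ediv_add_emod m N
      rw [Finset.mem_biUnion]
      refine ⟨m / N, hdiv ▸ hmem x hx, ?_⟩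
      rw [Finset.mem_image]
      refine ⟨(m % N).toNat, ?_, by rw [hcast, hsum]⟩
      rw [Finset.mem_erase, Finset.mem_range]
      refine ⟨fun h => ?_, by omega⟩
      apply hjE (m / N) x hx
      rw [← h, hcast, hsum]

/-- A uniformly porous subset of the line misses some `N`-adic subinterval of each `N`-adic
interval. -/
lemma exists_gap_of_porous {E : Set ℝ} {κ : ℝ}
    (hpor : ∀ x ∈ E, ∀ r : ℝ, 0 < r → r ≤ 1 → ∃ t : ℝ, |t| ≤ r ∧ ∀ y ∈ E, κ * r ≤ |x + t - y|)
    {N : ℕ} (hN : 8 ≤ N) (hNκ : 8 ≤ κ * N) (n : ℕ) (k : ℤ) :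
    ∃ j ∈ Finset.range N, ∀ x ∈ E, ⌊x * (N : ℝ) ^ (n + 1)⌋ ≠ k * N + j := by
  have hN8 : (8 : ℝ) ≤ N := by exact_mod_cast hN
  have hN0 : (0 : ℝ) < N := by linarith
  set P : ℝ := (N : ℝ) ^ n with hP
  have hP1 : 1 ≤ P := one_le_pow₀ (by linarith)
  have hP0 : 0 < P := by linarith
  -- The child containing `z` will be the gap, so `z` must be inside interval `k` and at least one
  -- child length from `E`. If `E` meets the middle half, porosity at scale `1 / (8 * P)` moves that
  -- point by at most an eighth of the interval, to a hole of radius at least `1 / (P * N)`.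
  -- Otherwise the midpoint works.
  obtain ⟨z, hz, hzE⟩ : ∃ z : ℝ, |z * P - (k + 1 / 2)| ≤ 3 / 8 ∧
      ∀ y ∈ E, 1 ≤ |z - y| * (P * N) := by
    by_cases h : ∃ x ∈ E, |x * P - (k + 1 / 2)| ≤ 1 / 4
    · obtain ⟨x, hxE, hx⟩ := h
      obtain ⟨t, ht, hty⟩ := hpor x hxE (1 / (8 * P)) (by positivity)
        (by rw [div_le_one (by positivity)]; linarith)
      refine ⟨x + t, ?_, fun y hy => ?_⟩
      · have h1 : |t * P| ≤ 1 / 8 := by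
          rw [abs_mul, abs_of_pos hP0]
          calc |t| * P ≤ 1 / (8 * P) * P := by gcongr
            _ = 1 / 8 := by field_simp
        calc |(x + t) * P - (k + 1 / 2)| = |(x * P - (k + 1 / 2)) + t * P| := by ring_nf
          _ ≤ |x * P - (k + 1 / 2)| + |t * P| := abs_add_le _ _
          _ ≤ 3 / 8 := by linarith
      · calc (1 : ℝ) ≤ κ * N / 8 := by linarith
          _ = κ * (1 / (8 * P)) * (P * N) := by field_simp
          _ ≤ _ := by gcongr; exact hty y hy
    · push Not at h
      refine ⟨(k + 1 / 2) / P, ?_, fun y hy => ?_⟩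
      · rw [div_mul_cancel₀ _ hP0.ne']; norm_num
      · have h1 := h y hy
        have h2 : |(k + 1 / 2) / P - y| * P = |y * P - (k + 1 / 2)| := by
          rw [← abs_of_pos hP0, ← abs_mul, abs_of_pos hP0, sub_mul, div_mul_cancel₀ _ hP0.ne',
            abs_sub_comm]
        rw [← mul_assoc, h2]
        nlinarith
  obtain ⟨hz1, hz2⟩ := abs_le.1 hz
  have e : z * (N : ℝ) ^ (n + 1) = z * P * N := by rw [hP, pow_succ, mul_assoc]
  have hlow : k * N ≤ ⌊z * (N : ℝ) ^ (n + 1)⌋ := by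
    rw [Int.le_floor, e]
    push_cast
    gcongr
    linarith
  have hup : ⌊z * (N : ℝ) ^ (n + 1)⌋ < k * N + N := by
    rw [Int.floor_lt, e]
    push_cast
    calc z * P * N < (k + 1) * N := by gcongr; linarith
      _ = _ := by ring
  refine ⟨(⌊z * (N : ℝ) ^ (n + 1)⌋ - k * N).toNat, by rw [Finset.mem_range]; omega, ?_⟩
  intro y hy hyk
  have hfl : ⌊y * (N : ℝ) ^ (n + 1)⌋ = ⌊z * (N : ℝ) ^ (n + 1)⌋ := by
    rw [hyk, Int.toNat_of_nonneg (by omega)]; ring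
  have h1 := Int.abs_sub_lt_one_of_floor_eq_floor hfl
  have h2 := hzE y hy
  rw [← sub_mul, abs_mul, abs_of_pos (by positivity : (0 : ℝ) < (N : ℝ) ^ (n + 1)), pow_succ,
    abs_sub_comm] at h1
  linarith

lemma eventually_real_closedBall_le_rpow {ν : Measure Plane} {x : Plane} {d s : ℝ} (hs : s < d)
    (h : Tendsto (fun r : ℝ => Real.log (ν.real (Metric.closedBall x r)) / Real.log r)
      (𝓝[>] 0) (𝓝 d)) :
    ∀ᶠ r in 𝓝[>] (0 : ℝ), ν.real (Metric.closedBall x r) ≤ r ^ s := by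
  have h1 : ∀ᶠ r in 𝓝[>] (0 : ℝ), r < 1 :=
    nhdsWithin_le_nhds (eventually_lt_nhds one_pos)
  filter_upwards [h.eventually (eventually_gt_nhds hs), h1, self_mem_nhdsWithin] with r hr hr1 hr0
  have hr0 : 0 < r := hr0
  -- A null ball is treated apart, since `Real.log 0 = 0` carries no information.
  rcases measureReal_nonneg (μ := ν) (s := Metric.closedBall x r) |>.eq_or_lt with h0 | h0
  · rw [← h0]
    positivity
  · have hlog := Real.log_neg hr0 hr1
    rw [lt_div_iff_of_neg hlog] at hr
    rw [← Real.log_le_log_iff h0 (by positivity), Real.log_rpow hr0]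
    exact hr.le

/-- A measure carried by a set that, in a distance controlling coordinate, meets at most
`C * (N - 1) ^ n` of the `N`-adic intervals of level `n`, is not exact dimensional of
dimension `1`. -/
lemma not_isExactDimensional_one_of_floor_mem {ν : Measure Plane} [IsProbabilityMeasure ν]
    {K : Set Plane} (hK : ∀ᵐ x ∂ν, x ∈ K) {c : Plane → ℝ}
    (hc : ∀ x ∈ K, ∀ y ∈ K, dist y x ≤ |c y - c x|) {N C : ℕ} (hN : 2 ≤ N)
    (hcov : ∀ n : ℕ, ∃ S : Finset ℤ, S.card ≤ C * (N - 1) ^ n ∧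
      ∀ x ∈ K, ⌊c x * (N : ℝ) ^ n⌋ ∈ S) :
    ¬ IsExactDimensional ν 1 := by
  intro hdim
  have hN2 : (2 : ℝ) ≤ N := by exact_mod_cast hN
  have hN0 : (0 : ℝ) < N := by linarith
  have hlogN : 0 < Real.log N := Real.log_pos (by linarith)
  have hlt : Real.log ((N : ℝ) - 1) / Real.log N < 1 := by
    rw [div_lt_one hlogN]
    exact Real.log_lt_log (by linarith) (by linarith)
  -- The exponent `s` lies strictly between the box dimension bound and `1`, so that `N - 1 < N ^
  -- s`.
  obtain ⟨s, hs, hs1⟩ := exists_between hlt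
  have hNs : (N : ℝ) - 1 < (N : ℝ) ^ s := by
    rw [div_lt_iff₀ hlogN, ← Real.log_rpow hN0] at hs
    exact (Real.log_lt_log_iff (by linarith) (by positivity)).1 hs
  have hpow : Tendsto (fun n : ℕ => ((N : ℝ) ^ n)⁻¹) atTop (𝓝[>] 0) := by
    refine tendsto_nhdsWithin_iff.2 ⟨?_, Eventually.of_forall fun n => ?_⟩
    · exact tendsto_inv_atTop_zero.comp (tendsto_pow_atTop_atTop_of_one_lt (by linarith))
    · exact Set.mem_Ioi.2 (by positivity)
  -- Points where the ball estimate holds from level `n` on. These sets exhaust almost everything,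
  -- yet each is null on `K`: at level `m` it splits into at most `C * (N - 1) ^ m` pieces of mass
  -- at most `N ^ (-m * s)`.
  set A : ℕ → Set Plane := fun n => {x | ∀ m ≥ n,
    ν.real (Metric.closedBall x ((N : ℝ) ^ m)⁻¹) ≤ (((N : ℝ) ^ m)⁻¹) ^ s} with hA
  have hae : ∀ᵐ x ∂ν, x ∈ ⋃ n, A n ∩ K := by
    filter_upwards [hdim, hK] with x hx hxK
    obtain ⟨n, hn⟩ := eventually_atTop.1
      (hpow.eventually (eventually_real_closedBall_le_rpow hs1 hx))
    exact Set.mem_iUnion.2 ⟨n, hn, hxK⟩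
  have hnull : ∀ n, ν (A n ∩ K) = 0 := by
    intro n
    have hle : ∀ m ≥ n, ν.real (A n ∩ K) ≤ C * (((N : ℝ) - 1) / (N : ℝ) ^ s) ^ m := by
      intro m hm
      obtain ⟨S, hS, hSK⟩ := hcov m
      have hsub : A n ∩ K ⊆ ⋃ k ∈ S, (A n ∩ K) ∩ {x | ⌊c x * (N : ℝ) ^ m⌋ = k} := by
        intro x hx
        exact Set.mem_biUnion (hSK x hx.2) ⟨hx, rfl⟩
      have hpiece : ∀ k ∈ S, ν.real ((A n ∩ K) ∩ {x | ⌊c x * (N : ℝ) ^ m⌋ = k})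
          ≤ (((N : ℝ) ^ m)⁻¹) ^ s := by
        intro k _
        rcases ((A n ∩ K) ∩ {x | ⌊c x * (N : ℝ) ^ m⌋ = k}).eq_empty_or_nonempty with h | ⟨x, hx⟩
        · rw [h, measureReal_empty]
          positivity
        · refine (measureReal_mono fun y hy => ?_).trans (hx.1.1 m hm)
          rw [Metric.mem_closedBall]
          refine (hc x hx.1.2 y hy.1.2).trans ?_
          have h1 := Int.abs_sub_lt_one_of_floor_eq_floor (hy.2.trans hx.2.symm)
          rw [← sub_mul, abs_mul, abs_of_pos (by positivity : (0 : ℝ) < (N : ℝ) ^ m)] at h1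
          rw [← one_div, le_div_iff₀ (by positivity)]
          exact h1.le
      have hS' : (S.card : ℝ) ≤ C * ((N : ℝ) - 1) ^ m := by
        have : (S.card : ℝ) ≤ ((C * (N - 1) ^ m : ℕ) : ℝ) := by exact_mod_cast hS
        rwa [Nat.cast_mul, Nat.cast_pow, Nat.cast_sub (by omega), Nat.cast_one] at this
      calc ν.real (A n ∩ K) ≤ _ := measureReal_mono hsub (measure_ne_top _ _)
        _ ≤ ∑ k ∈ S, ν.real ((A n ∩ K) ∩ {x | ⌊c x * (N : ℝ) ^ m⌋ = k}) :=
            measureReal_biUnion_finset_le _ _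
        _ ≤ ∑ _k ∈ S, (((N : ℝ) ^ m)⁻¹) ^ s := Finset.sum_le_sum hpiece
        _ = S.card * (((N : ℝ) ^ m)⁻¹) ^ s := by rw [Finset.sum_const, nsmul_eq_mul]
        _ ≤ C * ((N : ℝ) - 1) ^ m * (((N : ℝ) ^ m)⁻¹) ^ s := by gcongr
        _ = _ := by
            rw [div_pow, Real.inv_rpow (by positivity), ← Real.rpow_natCast, ← Real.rpow_natCast,
              ← Real.rpow_natCast, ← Real.rpow_mul hN0.le, ← Real.rpow_mul hN0.le, mul_comm (m : ℝ) s]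
            ring
    have hq : Tendsto (fun m : ℕ => C * (((N : ℝ) - 1) / (N : ℝ) ^ s) ^ m) atTop (𝓝 (C * 0)) := by
      refine (tendsto_pow_atTop_nhds_zero_of_lt_one ?_ ?_).const_mul _
      · exact div_nonneg (by linarith) (by positivity)
      · rw [div_lt_one (by positivity)]
        exact hNs
    have h0 : ν.real (A n ∩ K) ≤ C * 0 :=
      ge_of_tendsto hq (eventually_atTop.2 ⟨n, hle⟩)
    rw [mul_zero] at h0
    exact (measureReal_eq_zero_iff).1 (le_antisymm h0 measureReal_nonneg)
  have hnot := measure_eq_zero_iff_ae_notMem.1 (measure_iUnion_null_iff.2 hnull)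
  obtain ⟨x, hx, hx'⟩ := (hae.and hnot).exists
  exact hx' hx

lemma not_isExactDimensional_one_of_porous {ν : Measure Plane} [IsProbabilityMeasure ν]
    {K : Set Plane} (hK : ∀ᵐ x ∂ν, x ∈ K) {c : Plane → ℝ}
    (hc : ∀ x ∈ K, ∀ y ∈ K, dist y x ≤ |c y - c x|) (hbdd : Bornology.IsBounded (c '' K))
    {κ : ℝ} (hκ : 0 < κ)
    (hpor : ∀ x ∈ c '' K, ∀ r : ℝ, 0 < r → r ≤ 1 →
      ∃ t : ℝ, |t| ≤ r ∧ ∀ y ∈ c '' K, κ * r ≤ |x + t - y|) :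
    ¬ IsExactDimensional ν 1 := by
  obtain ⟨M, hM⟩ := exists_nat_ge (8 / κ)
  have hN : 8 ≤ max M 8 := le_max_right _ _
  have hNκ : 8 ≤ κ * (max M 8 : ℕ) := by
    have : 8 / κ ≤ (max M 8 : ℕ) := hM.trans (by exact_mod_cast le_max_left _ _)
    rwa [div_le_iff₀ hκ, mul_comm] at this
  have hfin : ((fun x : ℝ => ⌊x⌋) '' (c '' K)).Finite := by
    obtain ⟨R, hR⟩ := hbdd.subset_closedBall 0
    refine (Set.finite_Icc ⌊-R⌋ ⌊R⌋).subset ?_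
    rintro _ ⟨x, hx, rfl⟩
    have := hR hx
    rw [Real.closedBall_eq_Icc, zero_sub, zero_add] at this
    exact ⟨Int.floor_le_floor this.1, Int.floor_le_floor this.2⟩
  obtain ⟨C, hC⟩ := exists_finset_floor_mem_of_gap (by omega) hfin
    (exists_gap_of_porous hpor hN hNκ)
  refine not_isExactDimensional_one_of_floor_mem hK hc (N := max M 8) (C := C) (by omega)
    fun n => ?_
  obtain ⟨S, hS, hS'⟩ := hC n
  exact ⟨S, hS, fun x hx => hS' _ (Set.mem_image_of_mem c hx)⟩

/-! ### Porosity of attractors under strong separation -/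

namespace SimilarityIFS

variable {l : ℕ} {Φ : SimilarityIFS l} {F : Set Plane} {V : Submodule ℝ Plane}

lemma abs_ratio_pos (Φ : SimilarityIFS l) (i : Fin l) : 0 < |Φ.ratio i| :=
  abs_pos.2 (Φ.ratio_ne_zero i)

lemma nonempty_index (Φ : SimilarityIFS l) : Nonempty (Fin l) :=
  ⟨⟨0, by have := Φ.two_le; omega⟩⟩

lemma exists_abs_ratio_le (Φ : SimilarityIFS l) :
    ∃ ρ : ℝ, 0 < ρ ∧ ρ < 1 ∧ ∀ i, |Φ.ratio i| ≤ ρ := by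
  have := Φ.nonempty_index
  obtain ⟨i, hi⟩ := Finite.exists_max fun i => |Φ.ratio i|
  exact ⟨_, Φ.abs_ratio_pos i, Φ.abs_ratio_lt_one i, hi⟩

lemma exists_le_abs_ratio (Φ : SimilarityIFS l) :
    ∃ a : ℝ, 0 < a ∧ a < 1 ∧ ∀ i, a ≤ |Φ.ratio i| := by
  have := Φ.nonempty_index
  obtain ⟨i, hi⟩ := Finite.exists_min fun i => |Φ.ratio i|
  exact ⟨_, Φ.abs_ratio_pos i, Φ.abs_ratio_lt_one i, hi⟩

lemma dist_toMap (Φ : SimilarityIFS l) (i : Fin l) (x y : Plane) :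
    dist (Φ.toMap i x) (Φ.toMap i y) = |Φ.ratio i| * dist x y := by
  rw [toMap, toMap, dist_add_right, dist_smul₀, LinearIsometryEquiv.dist_map, Real.norm_eq_abs]

lemma toMap_injective (Φ : SimilarityIFS l) (i : Fin l) : Function.Injective (Φ.toMap i) := by
  intro x y h
  have := Φ.dist_toMap i x y
  rw [h, dist_self, eq_comm, mul_eq_zero] at this
  exact dist_eq_zero.1 (this.resolve_left (Φ.abs_ratio_pos i).ne')

lemma continuous_toMap (Φ : SimilarityIFS l) (i : Fin l) : Continuous (Φ.toMap i) := by
  unfold toMap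
  exact (((Φ.orth i).continuous).const_smul (Φ.ratio i)).add continuous_const

lemma toMap_add (Φ : SimilarityIFS l) (i : Fin l) (x v : Plane) :
    Φ.toMap i (x + v) = Φ.toMap i x + Φ.ratio i • Φ.orth i v := by
  rw [toMap, toMap, map_add, smul_add]
  abel

lemma norm_ratio_smul_orth (Φ : SimilarityIFS l) (i : Fin l) (v : Plane) :
    ‖Φ.ratio i • Φ.orth i v‖ = |Φ.ratio i| * ‖v‖ := by
  rw [norm_smul, LinearIsometryEquiv.norm_map, Real.norm_eq_abs]

lemma IsAttractor.toMap_mem (hF : Φ.IsAttractor F) (i : Fin l) {x : Plane} (hx : x ∈ F) :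
    Φ.toMap i x ∈ F := by
  rw [hF.2.2]
  exact Set.mem_iUnion.2 ⟨i, x, hx, rfl⟩

lemma IsAttractor.exists_toMap_eq (hF : Φ.IsAttractor F) {x : Plane} (hx : x ∈ F) :
    ∃ i, ∃ x' ∈ F, Φ.toMap i x' = x := by
  rw [hF.2.2] at hx
  obtain ⟨i, x', hx', h⟩ := Set.mem_iUnion.1 hx
  exact ⟨i, x', hx', h⟩

lemma IsAttractor.isCompact_image (hF : Φ.IsAttractor F) (i : Fin l) :
    IsCompact (Φ.toMap i '' F) :=
  hF.2.1.image (Φ.continuous_toMap i)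

lemma IsAttractor.exists_le_dist (hF : Φ.IsAttractor F)
    (hdisj : ∀ i j, i ≠ j → Disjoint (Φ.toMap i '' F) (Φ.toMap j '' F)) :
    ∃ δ : ℝ, 0 < δ ∧ ∀ i j, i ≠ j → ∀ x ∈ F, ∀ y ∈ F, δ ≤ dist (Φ.toMap i x) (Φ.toMap j y) := by
  have h : ∀ q : Fin l × Fin l, ∃ δ : ℝ, 0 < δ ∧ (q.1 ≠ q.2 →
      ∀ x ∈ F, ∀ y ∈ F, δ ≤ dist (Φ.toMap q.1 x) (Φ.toMap q.2 y)) := by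
    intro q
    by_cases hq : q.1 = q.2
    · exact ⟨1, one_pos, fun h => absurd hq h⟩
    obtain ⟨δ, hδ, hd⟩ := (hdisj _ _ hq).exists_thickenings (hF.isCompact_image q.1)
      (hF.isCompact_image q.2).isClosed
    refine ⟨δ, hδ, fun _ x hx y hy => ?_⟩
    by_contra! hlt
    refine (Set.disjoint_left.1 hd (?_ : Φ.toMap q.2 y ∈ _)) ?_
    · exact Metric.mem_thickening_iff.2 ⟨_, Set.mem_image_of_mem _ hx, by rwa [dist_comm]⟩
    · exact Metric.self_subset_thickening hδ _ (Set.mem_image_of_mem _ hy)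
  choose δ hδ hd using h
  have := Φ.nonempty_index
  obtain ⟨q, hq⟩ := Finite.exists_min δ
  exact ⟨δ q, hδ q, fun i j hij x hx y hy => (hq (i, j)).trans (hd (i, j) hij x hx y hy)⟩

/-- Otherwise `F` contains a segment in direction `V`. The pieces are closed and disjoint, so the
segment stays in one of them, and its preimage is a segment in `F` longer by a factor at least `1 /
ρ`. -/
lemma IsAttractor.exists_add_notMem (hF : Φ.IsAttractor F)
    (hdisj : ∀ i j, i ≠ j → Disjoint (Φ.toMap i '' F) (Φ.toMap j '' F))
    (hV : ∀ i, ∀ v ∈ V, Φ.orth i v ∈ V) {u : Plane} (hu : ‖u‖ = 1) (huV : u ∈ V)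
    {x : Plane} (hx : x ∈ F) {r : ℝ} (hr : 0 < r) : ∃ v ∈ V, ‖v‖ ≤ r ∧ x + v ∉ F := by
  by_contra! hcon
  obtain ⟨ρ, hρ0, hρ1, hρ⟩ := Φ.exists_abs_ratio_le
  have key : ∀ n : ℕ, ∃ x ∈ F, ∀ v ∈ V, ‖v‖ ≤ r / ρ ^ n → x + v ∈ F := by
    intro n
    induction n with
    | zero => exact ⟨x, hx, fun v hv hvr => hcon v hv (by simpa using hvr)⟩
    | succ n ih =>
      obtain ⟨x, hx, hxV⟩ := ih
      obtain ⟨i, x', hx', rfl⟩ := hF.exists_toMap_eq hx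
      set s : Set Plane := (fun v => Φ.toMap i x' + v) '' (Metric.closedBall 0 (r / ρ ^ n) ∩ V)
        with hs
      have hconn : IsPreconnected s :=
        ((convex_closedBall _ _).inter V.convex).isPreconnected.image _ (by fun_prop)
      have hxs : Φ.toMap i x' ∈ s := ⟨0, ⟨by simp; positivity, V.zero_mem⟩, add_zero _⟩
      have hsF : s ⊆ F := by
        rintro _ ⟨v, ⟨hv, hvV⟩, rfl⟩
        exact hxV v hvV (by simpa using hv)
      have hsi : s ⊆ Φ.toMap i '' F := by
        refine (isPreconnected_iff_subset_of_disjoint_closed.1 hconn (Φ.toMap i '' F)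
          (⋃ j ∈ {j | j ≠ i}, Φ.toMap j '' F) (hF.isCompact_image i).isClosed ?_ ?_ ?_).resolve_right
          ?_
        · exact (Set.toFinite _).isClosed_biUnion fun j _ => (hF.isCompact_image j).isClosed
        · intro y hy
          obtain ⟨j, y', hy', rfl⟩ := hF.exists_toMap_eq (hsF hy)
          by_cases hj : j = i
          · exact Or.inl ⟨y', hy', by rw [hj]⟩
          · exact Or.inr (Set.mem_biUnion (show j ∈ {j | j ≠ i} from hj) ⟨y', hy', rfl⟩)
        · rw [Set.eq_empty_iff_forall_notMem]
          rintro y ⟨_, hy, hy'⟩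
          obtain ⟨j, hj, hyj⟩ := Set.mem_iUnion₂.1 hy'
          exact Set.disjoint_left.1 (hdisj j i hj) hyj hy
        · intro h
          obtain ⟨j, hj, hyj⟩ := Set.mem_iUnion₂.1 (h hxs)
          exact Set.disjoint_left.1 (hdisj j i hj) hyj ⟨x', hx', rfl⟩
      refine ⟨x', hx', fun v hv hvr => ?_⟩
      have hmem : Φ.toMap i (x' + v) ∈ s := by
        refine ⟨Φ.ratio i • Φ.orth i v, ⟨?_, V.smul_mem _ (hV i v hv)⟩, (Φ.toMap_add i x' v).symm⟩
        rw [mem_closedBall_zero_iff, norm_ratio_smul_orth]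
        calc |Φ.ratio i| * ‖v‖ ≤ ρ * (r / ρ ^ (n + 1)) := by
              gcongr
              exact hρ i
          _ = r / ρ ^ n := by rw [pow_succ]; field_simp
      obtain ⟨z, hz, hzv⟩ := hsi hmem
      rwa [← Φ.toMap_injective i hzv]
  obtain ⟨n, hn⟩ := exists_pow_lt_of_lt_one (show 0 < r / (Metric.diam F + 1) by positivity) hρ1
  obtain ⟨y, hy, hyV⟩ := key n
  have hpos : 0 < r / ρ ^ n := by positivity
  have hnorm : ‖(r / ρ ^ n) • u‖ = r / ρ ^ n := by
    rw [norm_smul, hu, mul_one, Real.norm_of_nonneg hpos.le]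
  have hd := Metric.dist_le_diam_of_mem hF.2.1.isBounded
    (hyV _ (V.smul_mem _ huV) hnorm.le) hy
  rw [dist_self_add_left, hnorm, div_le_iff₀ (by positivity)] at hd
  rw [lt_div_iff₀ (by positivity)] at hn
  nlinarith [pow_pos hρ0 n]

/-- For nearby base points the same `v` works with half the distance to `F`; compactness makes the
bound uniform. -/
lemma IsAttractor.exists_uniform_gap (hF : Φ.IsAttractor F)
    (hdisj : ∀ i j, i ≠ j → Disjoint (Φ.toMap i '' F) (Φ.toMap j '' F))
    (hV : ∀ i, ∀ v ∈ V, Φ.orth i v ∈ V) {u : Plane} (hu : ‖u‖ = 1) (huV : u ∈ V)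
    {r : ℝ} (hr : 0 < r) :
    ∃ δ : ℝ, 0 < δ ∧ ∀ x ∈ F, ∃ v ∈ V, ‖v‖ ≤ r ∧ ∀ y ∈ F, δ ≤ dist (x + v) y := by
  refine hF.2.1.induction_on (p := fun s => ∃ δ : ℝ, 0 < δ ∧ ∀ x ∈ s, ∃ v ∈ V, ‖v‖ ≤ r ∧
    ∀ y ∈ F, δ ≤ dist (x + v) y) ⟨1, one_pos, by simp⟩ ?_ ?_ ?_
  · rintro s t hst ⟨δ, hδ, h⟩
    exact ⟨δ, hδ, fun x hx => h x (hst hx)⟩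
  · rintro s t ⟨δ, hδ, h⟩ ⟨δ', hδ', h'⟩
    refine ⟨min δ δ', lt_min hδ hδ', ?_⟩
    rintro x (hx | hx)
    · obtain ⟨v, hv, hvr, hvy⟩ := h x hx
      exact ⟨v, hv, hvr, fun y hy => (min_le_left _ _).trans (hvy y hy)⟩
    · obtain ⟨v, hv, hvr, hvy⟩ := h' x hx
      exact ⟨v, hv, hvr, fun y hy => (min_le_right _ _).trans (hvy y hy)⟩
  · intro x hx
    obtain ⟨v, hv, hvr, hxv⟩ := hF.exists_add_notMem hdisj hV hu huV hx hr
    have hpos := (hF.2.1.isClosed.notMem_iff_infDist_pos hF.1).1 hxv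
    set ε := Metric.infDist (x + v) F with hε
    refine ⟨Metric.ball x (ε / 2), nhdsWithin_le_nhds (Metric.ball_mem_nhds x (by positivity)),
      ε / 2, by positivity, fun x' hx' => ⟨v, hv, hvr, fun y hy => ?_⟩⟩
    have h1 : ε ≤ dist (x + v) y := Metric.infDist_le_dist_of_mem hy
    have h2 : dist (x + v) y ≤ dist (x + v) (x' + v) + dist (x' + v) y := dist_triangle _ _ _
    rw [dist_add_right, dist_comm x x'] at h2
    have h3 : dist x' x < ε / 2 := hx'
    linarith

/-- Under strong separation the attractor is uniformly porous along every line whose direction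
is preserved by the orthogonal parts. -/
lemma IsAttractor.exists_porous (hF : Φ.IsAttractor F)
    (hdisj : ∀ i j, i ≠ j → Disjoint (Φ.toMap i '' F) (Φ.toMap j '' F))
    (hV : ∀ i, ∀ v ∈ V, Φ.orth i v ∈ V) {u : Plane} (hu : ‖u‖ = 1) (huV : u ∈ V) :
    ∃ κ : ℝ, 0 < κ ∧ ∀ x ∈ F, ∀ r : ℝ, 0 < r → r ≤ 1 →
      ∃ v ∈ V, ‖v‖ ≤ r ∧ ∀ y ∈ F, κ * r ≤ dist (x + v) y := by
  obtain ⟨ρ, hρ0, hρ1, hρ⟩ := Φ.exists_abs_ratio_le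
  obtain ⟨a, ha0, ha1, ha⟩ := Φ.exists_le_abs_ratio
  obtain ⟨c, hc, hsep⟩ := hF.exists_le_dist hdisj
  set R : ℝ := min 1 (c / 2) with hR
  have hR0 : 0 < R := lt_min one_pos (by positivity)
  obtain ⟨δ, hδ, hgap⟩ := hF.exists_uniform_gap hdisj hV hu huV (r := a * R) (by positivity)
  set κ : ℝ := min 1 (δ / R) with hκ
  have hκ0 : 0 < κ := lt_min one_pos (by positivity)
  -- Scales in `[a * R, R]` are settled by compactness. A smaller `r` is pulled back through the
  -- piece containing `x`; as every ratio is at least `a`, the new scale does not exceed `R`.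
  have key : ∀ n : ℕ, ∀ x ∈ F, ∀ r : ℝ, ρ ^ n * (a * R) ≤ r → r ≤ R →
      ∃ v ∈ V, ‖v‖ ≤ r ∧ ∀ y ∈ F, κ * r ≤ dist (x + v) y := by
    have base : ∀ x ∈ F, ∀ r : ℝ, a * R ≤ r → r ≤ R →
        ∃ v ∈ V, ‖v‖ ≤ r ∧ ∀ y ∈ F, κ * r ≤ dist (x + v) y := by
      intro x hx r hr hrR
      obtain ⟨v, hv, hvr, hvy⟩ := hgap x hx
      refine ⟨v, hv, hvr.trans hr, fun y hy => le_trans ?_ (hvy y hy)⟩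
      calc κ * r ≤ δ / R * R := by
            gcongr
            · exact (by positivity : (0 : ℝ) ≤ a * R).trans hr
            · exact min_le_right _ _
        _ = δ := by field_simp
    intro n
    induction n with
    | zero => simpa using base
    | succ n ih =>
      intro x hx r hr hrR
      rcases le_total (a * R) r with har | har
      · exact base x hx r har hrR
      have hr0 : 0 < r := lt_of_lt_of_le (by positivity) hr
      obtain ⟨i, x', hx', rfl⟩ := hF.exists_toMap_eq hx
      have hi := Φ.abs_ratio_pos i
      have hlow : ρ ^ n * (a * R) ≤ r / |Φ.ratio i| := by
        rw [le_div_iff₀ hi]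
        refine le_trans ?_ hr
        calc ρ ^ n * (a * R) * |Φ.ratio i| ≤ ρ ^ n * (a * R) * ρ :=
              mul_le_mul_of_nonneg_left (hρ i) (by positivity)
          _ = ρ ^ (n + 1) * (a * R) := by ring
      have hup : r / |Φ.ratio i| ≤ R := by
        rw [div_le_iff₀ hi, mul_comm]
        exact har.trans (mul_le_mul_of_nonneg_right (ha i) hR0.le)
      obtain ⟨v, hv, hvr, hvy⟩ := ih x' hx' (r / |Φ.ratio i|) hlow hup
      rw [le_div_iff₀ hi, mul_comm] at hvr
      refine ⟨Φ.ratio i • Φ.orth i v, V.smul_mem _ (hV i v hv), ?_, fun y hy => ?_⟩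
      · rwa [norm_ratio_smul_orth]
      obtain ⟨j, y', hy', rfl⟩ := hF.exists_toMap_eq hy
      rcases eq_or_ne i j with rfl | hij
      · rw [← toMap_add, dist_toMap]
        calc κ * r = |Φ.ratio i| * (κ * (r / |Φ.ratio i|)) := by field_simp
          _ ≤ _ := by gcongr; exact hvy y' hy'
      -- The other pieces are at distance at least `c`, and the shift is at most `R ≤ c / 2`, so
      -- they remain at least `c / 2` away.
      · have h1 := hsep i j hij x' hx' y' hy'
        have h2 := dist_triangle_left (Φ.toMap i x') (Φ.toMap j y')
          (Φ.toMap i x' + Φ.ratio i • Φ.orth i v)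
        rw [dist_self_add_left, norm_ratio_smul_orth] at h2
        have h3 : R ≤ c / 2 := min_le_right _ _
        have h4 : κ * r ≤ r := mul_le_of_le_one_left hr0.le (min_le_left _ _)
        linarith
  refine ⟨κ * R, by positivity, fun x hx r hr hr1 => ?_⟩
  obtain ⟨n, hn⟩ := exists_pow_lt_of_lt_one (show 0 < r / a by positivity) hρ1
  have hle : ρ ^ n * (a * R) ≤ r * R := by
    rw [lt_div_iff₀ ha0] at hn
    rw [← mul_assoc]
    gcongr
  obtain ⟨v, hv, hvr, hvy⟩ := key n x hx (r * R) hle (mul_le_of_le_one_left hR0.le hr1)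
  refine ⟨v, hv, hvr.trans (mul_le_of_le_one_right hr.le (min_le_left _ _)), fun y hy => ?_⟩
  calc κ * R * r = κ * (r * R) := by ring
    _ ≤ _ := hvy y hy

/-! ### Self-similar measures live on the attractor -/

lemma IsAttractor.infDist_toMap_le (hF : Φ.IsAttractor F) {ρ : ℝ} (hρ : ∀ i, |Φ.ratio i| ≤ ρ)
    (i : Fin l) (x : Plane) :
    Metric.infDist (Φ.toMap i x) F ≤ ρ * Metric.infDist x F := by
  obtain ⟨y, hy, hxy⟩ := hF.2.1.exists_infDist_eq_dist hF.1 x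
  rw [hxy]
  refine (Metric.infDist_le_dist_of_mem (hF.toMap_mem i hy)).trans ?_
  rw [dist_toMap]
  gcongr
  exact hρ i

/-- Each map contracts the distance to `F` by at least `ρ`, so the mass beyond distance `R` is at
most the mass beyond `R / ρ ^ n`, which tends to zero. -/
lemma IsSelfSimilarMeasure.ae_mem_attractor {μ : Measure Plane} (hμ : Φ.IsSelfSimilarMeasure μ)
    (hF : Φ.IsAttractor F) : ∀ᵐ x ∂μ, x ∈ F := by
  obtain ⟨hprob, p, _, hp1, hμp⟩ := hμ
  obtain ⟨ρ, hρ0, hρ1, hρ⟩ := Φ.exists_abs_ratio_le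
  set A : ℝ → Set Plane := fun R => {x | R < Metric.infDist x F} with hA
  have hAm : ∀ R, MeasurableSet (A R) := fun R =>
    (isOpen_lt continuous_const (Metric.continuous_infDist_pt F)).measurableSet
  have hstep : ∀ R, μ (A R) ≤ μ (A (R / ρ)) := by
    intro R
    calc μ (A R) = ∑ i, (p i : ENNReal) * μ (Φ.toMap i ⁻¹' A R) := by
          conv_lhs => rw [hμp]
          rw [Measure.finsetSum_apply]
          refine Finset.sum_congr rfl fun i _ => ?_
          rw [Measure.smul_apply, Measure.map_apply (Φ.continuous_toMap i).measurable (hAm R)]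
          rfl
      _ ≤ ∑ i, (p i : ENNReal) * μ (A (R / ρ)) := by
          gcongr with i
          intro x hx
          have h1 : R < Metric.infDist (Φ.toMap i x) F := hx
          have h2 := hF.infDist_toMap_le hρ i x
          change R / ρ < Metric.infDist x F
          rw [div_lt_iff₀ hρ0]
          linarith
      _ = μ (A (R / ρ)) := by
          rw [← Finset.sum_mul, ← ENNReal.ofNNReal_finsetSum, hp1, ENNReal.coe_one, one_mul]
  have hiter : ∀ R, ∀ n : ℕ, μ (A R) ≤ μ (A (R / ρ ^ n)) := by
    intro R n
    induction n with
    | zero => simp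
    | succ n ih =>
      refine ih.trans ((hstep _).trans_eq ?_)
      rw [div_div, pow_succ]
  have hzero : ∀ R : ℝ, 0 < R → μ (A R) = 0 := by
    intro R hR
    have hanti : Antitone fun n : ℕ => A (R / ρ ^ n) := by
      intro m n hmn x hx
      refine lt_of_le_of_lt ?_ (show R / ρ ^ n < Metric.infDist x F from hx)
      have := pow_le_pow_of_le_one hρ0.le hρ1.le hmn
      gcongr
    have hlim := tendsto_measure_iInter_atTop (μ := μ)
      (fun n => (hAm (R / ρ ^ n)).nullMeasurableSet) hanti ⟨0, measure_ne_top _ _⟩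
    have hempty : ⋂ n : ℕ, A (R / ρ ^ n) = ∅ := by
      rw [Set.eq_empty_iff_forall_notMem]
      intro x hx
      have hx0 : 0 ≤ Metric.infDist x F := Metric.infDist_nonneg
      obtain ⟨n, hn⟩ := exists_pow_lt_of_lt_one
        (show 0 < R / (Metric.infDist x F + 1) by positivity) hρ1
      have h1 : R / ρ ^ n < Metric.infDist x F := Set.mem_iInter.1 hx n
      rw [div_lt_iff₀ (by positivity)] at h1
      rw [lt_div_iff₀ (by positivity)] at hn
      nlinarith [pow_pos hρ0 n]
    rw [hempty, measure_empty] at hlim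
    exact le_antisymm (ge_of_tendsto' hlim (hiter R)) zero_le
  have hall : ∀ᵐ x ∂μ, ∀ n : ℕ, x ∉ A (1 / ((n : ℝ) + 1)) :=
    ae_all_iff.2 fun n => measure_eq_zero_iff_ae_notMem.1 (hzero _ (by positivity))
  filter_upwards [hall] with x hx
  by_contra hxF
  obtain ⟨n, hn⟩ := exists_nat_one_div_lt ((hF.2.1.isClosed.notMem_iff_infDist_pos hF.1).1 hxF)
  exact hx n hn

end SimilarityIFS

/-! ### Slices -/

/-- The joint law of the projection and the point is the composition product of the projected
measure with the slices, so almost sure properties of the pair pass to almost every slice. -/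
lemma ae_sliceMeasure {μ : Measure Plane} [IsFiniteMeasure μ] (V : Submodule ℝ Plane)
    {F : Set Plane} (hFm : MeasurableSet F) (hF : ∀ᵐ x ∂μ, x ∈ F) :
    ∀ᵐ y ∂(μ.map (Vᗮ.orthogonalProjectionOnto)), ∀ᵐ x ∂(sliceMeasure μ V y),
      x ∈ F ∧ Vᗮ.orthogonalProjectionOnto x = y := by
  have hP : Measurable (Vᗮ.orthogonalProjectionOnto : Plane → Vᗮ) :=
    (Vᗮ.orthogonalProjectionOnto).continuous.measurable
  have h : ∀ᵐ q ∂((μ.map (Vᗮ.orthogonalProjectionOnto)) ⊗ₘ sliceMeasure μ V),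
      q.2 ∈ F ∧ Vᗮ.orthogonalProjectionOnto q.2 = q.1 := by
    rw [sliceMeasure, compProd_map_condDistrib aemeasurable_id, ae_map_iff]
    · simpa using hF
    · exact (hP.prodMk measurable_id).aemeasurable
    · exact (measurable_snd hFm).inter (measurableSet_eq_fun (hP.comp measurable_snd) measurable_fst)
  have : IsMarkovKernel (sliceMeasure μ V) := by
    rw [sliceMeasure]
    infer_instance
  exact Measure.ae_ae_of_ae_compProd h

lemma not_admitsOneSlicing_of_SSC {l : ℕ} {Φ : SimilarityIFS l} {μ : Measure Plane}
    [IsProbabilityMeasure μ] (hμ : Φ.IsSelfSimilarMeasure μ) (hS : Φ.SSC) :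
    ¬ AdmitsOneSlicing Φ μ := by
  rintro ⟨V, hV1, hV, hdim⟩
  obtain ⟨F, hF, hdisj⟩ := hS
  obtain ⟨b, hb⟩ := exists_orthonormalBasis_span_singleton_eq hV1
  have hu : ‖b 0‖ = 1 := b.orthonormal.1 0
  have huV : b 0 ∈ V := hb ▸ Submodule.mem_span_singleton_self _
  have hV' : ∀ i, ∀ v ∈ V, Φ.orth i v ∈ V := by
    intro i v hv
    rw [← hV i]
    exact Submodule.mem_map_of_mem hv
  obtain ⟨κ, hκ, hpor⟩ := hF.exists_porous hdisj hV' hu huV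
  have hP : Measurable (Vᗮ.orthogonalProjectionOnto : Plane → Vᗮ) :=
    (Vᗮ.orthogonalProjectionOnto).continuous.measurable
  have := Measure.isProbabilityMeasure_map (μ := μ) hP.aemeasurable
  obtain ⟨y, hy1, hy2⟩ := (hdim.and (ae_sliceMeasure V hF.2.1.isClosed.measurableSet
    (hμ.ae_mem_attractor hF))).exists
  have hnorm : ∀ v ∈ V, ‖v‖ = |inner ℝ (b 0) v| := by
    intro v hv
    rw [hb] at hv
    obtain ⟨t, rfl⟩ := Submodule.mem_span_singleton.1 hv
    rw [norm_smul, inner_smul_right, real_inner_self_eq_norm_sq, hu]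
    simp
  have hsub : ∀ x x' : Plane, Vᗮ.orthogonalProjectionOnto x = y →
      Vᗮ.orthogonalProjectionOnto x' = y → x - x' ∈ V := by
    intro x x' hx hx'
    rw [← Submodule.orthogonal_orthogonal V, ← Submodule.orthogonalProjectionOnto_eq_zero_iff,
      map_sub, hx, hx', sub_self]
  have : IsProbabilityMeasure (sliceMeasure μ V y) := by
    rw [sliceMeasure]
    infer_instance
  -- The coordinate along `b 0` is isometric on the translate of `V`. The holes avoid all of `F`,
  -- and the shift stays within the translate, so they are holes of the slice.
  refine not_isExactDimensional_one_of_porous (ν := sliceMeasure μ V y)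
    (K := {x | x ∈ F ∧ Vᗮ.orthogonalProjectionOnto x = y}) hy2 (c := fun x => inner ℝ (b 0) x)
    ?_ ?_ hκ ?_ hy1
  · intro x hx x' hx'
    rw [dist_eq_norm, hnorm _ (hsub x' x hx'.2 hx.2), inner_sub_right]
  · exact ((hF.2.1.image (by fun_prop : Continuous fun x : Plane => inner ℝ (b 0) x)).isBounded).subset
      (Set.image_mono fun x hx => hx.1)
  · rintro _ ⟨x, hx, rfl⟩ r hr hr1
    obtain ⟨v, hv, hvr, hvy⟩ := hpor x hx.1 r hr hr1
    refine ⟨inner ℝ (b 0) v, hnorm v hv ▸ hvr, ?_⟩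
    rintro _ ⟨z, hz, rfl⟩
    refine (hvy z hz.1).trans_eq ?_
    rw [dist_eq_norm, add_sub_right_comm, hnorm _ (V.add_mem (hsub x z hx.2 hz.2) hv),
      inner_add_right, inner_sub_right]
    ring_nf

theorem mainTheorem8 {l : ℕ} (Φ : SimilarityIFS l) (μ : MeasureTheory.Measure Plane)
    [MeasureTheory.IsProbabilityMeasure μ] (hμ : Φ.IsSelfSimilarMeasure μ) :
    ((5 ≤ ENat.card Φ.orthGroup ∨
        2 < ENat.card (Φ.orthGroup ⊓ planeRotations : Subgroup PlaneOrthogonal)) →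
      ¬ AdmitsOneSlicing Φ μ) ∧
    (Φ.SSC → ¬ AdmitsOneSlicing Φ μ) := by
  refine ⟨?_, not_admitsOneSlicing_of_SSC hμ⟩
  rintro hcard ⟨V, hV1, hV, -⟩
  obtain ⟨b, rfl⟩ := exists_orthonormalBasis_span_singleton_eq hV1
  rcases hcard with h | h
  · exact absurd (h.trans (card_orthGroup_le_four b hV)) (by decide)
  · exact absurd h (card_orthGroup_inf_planeRotations_le_two b hV).not_gt
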